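/- A hypergraph $H=(V,E)$ consists of a set $V$ of vertices and a set $E$ of subsets of $V$, called edges; it is $n$-uniform if every edge has exactly $n$ elements. A proper $(a:b)$-coloring of $H$ assigns to each vertex a set of exactly $b$ of the colors $1,\dots,a$ in such a way that no color belongs to the sets of all vertices of one edge; $H$ is $(a:b)$-colorable if it has such a coloring. **Proposition.** Let $n\ge 2$ and $a$ be integers with $$3<a\le\sqrt{\frac{n}{100\ln n}}.$$ Then every $n$-uniform hypergraph $H=(V,E)$ with finitely many edges and $$|E|\le\frac{1}{20a^2}\left(\frac{n}{\ln n}\right)^{\frac{a-1}{a}}\left(\frac{a}{a-1}\right)^{n}$$ is $(a:a-1)$-colorable. -/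

import Mathlib

/-- Every edge of `H` has exactly `n` vertices. -/
def Hypergraph.IsUniform {α : Type*} (H : Hypergraph α) (n : ℕ) : Prop :=
  ∀ e ∈ H.edgeSet, e.encard = n

/-- `c` is a proper `(a:b)`-coloring of `H`: every vertex receives a set of exactly `b` of the `a`
colors, and no color is shared by all vertices of an edge. The values of `c` outside the vertex
set are irrelevant. -/
def Hypergraph.IsFractionalColoring {α : Type*} (H : Hypergraph α) (a b : ℕ)
    (c : α → Finset (Fin a)) : Prop :=
  (∀ v ∈ H.vertexSet, (c v).card = b) ∧ ∀ e ∈ H.edgeSet, ¬ ∃ i : Fin a, ∀ v ∈ e, i ∈ c v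

/-- `H` is `(a:b)`-colorable. -/
def Hypergraph.FractionallyColorable {α : Type*} (H : Hypergraph α) (a b : ℕ) : Prop :=
  ∃ c : α → Finset (Fin a), H.IsFractionalColoring a b c

/-! Giving each vertex all colours but one reduces the claim to a panchromatic colouring with `r =
a` colours: every edge meets every colour. Draw weights independently and uniformly from `[0, N)`,
`N = r * q + d`. The block `[k * q + d, (k + 1) * q)` gets colour `k`. In an inner overlap `[k * q,
k * q + d)` a vertex gets `k`, but drops to `k - 1` when it is the last chance of some edge to see
`k - 1` (`Low`). If an edge still misses a colour, tracing back which edge forced which drop gives a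
chain of edges, where each link is the last vertex of one edge and the first of the next in their
common overlap (`exists_chain`). These edges avoid disjoint sets of weights, whose sizes telescope
to `(l + 1) * q + d - l`.

Then a union bound over chains. With densities `f k` of the avoided sets, disjointness gives `(∏ (1
- f k)) ^ n` and a further factor `1 - φ ^ 2` for each vertex common to consecutive edges
(`one_sub_sum_le_prod`). That gain pays for choosing the link, however large the intersection
(`mul_pow_le_inv`). For `d = n` and `N ≈ n ^ 2 / log n`, the extra `d` in the total size saves `n ^
(1 - (l + 1) / r)` and each link costs `O(r ^ 2 * log n / n)`. The bound on the number of edges is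
what makes each pair `(j, l)` contribute less than `1 / r ^ 2` (`term_lt`). -/

namespace Panchromatic

open Finset

/-! ### The colouring rule and chains of edges -/

section Coloring

variable {V : Type*} (E : Finset (Finset V)) (σ : V → ℕ) (q d : ℕ)

/-- Whether a vertex `v` whose weight lies in `[b * q, b * q + d)` receives the colour `b - 1`
instead of `b`. -/
def Low : ℕ → V → Prop
  | 0, _ => False
  | b + 1, v => ∃ e ∈ E, v ∈ e ∧
      (∀ u ∈ e, (b + 1) * q ≤ σ u → σ u < (b + 1) * q + d → σ u ≤ σ v) ∧
      (∀ u ∈ e, ¬ (b * q + d ≤ σ u ∧ σ u < (b + 1) * q)) ∧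
      ∀ u ∈ e, b * q ≤ σ u → σ u < b * q + d → Low b u

open Classical in
/-- The colour of a vertex, computed from the weights. -/
noncomputable def color (r : ℕ) (v : V) : ℕ :=
  if σ v % q < d then
    -- The outermost overlaps are not shared: the top one always gets `r - 1`, the bottom one `0`
    -- because `Low 0` is false.
    if σ v / q = r then r - 1
    else if Low E σ q d (σ v / q) v then σ v / q - 1 else σ v / q
  else σ v / q

variable {E σ q d}

theorem color_lt {r : ℕ} (hr : 0 < r) {v : V} (hv : σ v < r * q + d) (hdq : d < q) :
    color E σ q d r v < r := by
  have hq : 0 < q := by omega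
  have hmod := Nat.div_add_mod (σ v) q
  have hle : σ v / q ≤ r := by
    by_contra! h
    have : q * (r + 1) ≤ q * (σ v / q) := Nat.mul_le_mul_left _ h
    have h3 : q * (r + 1) = r * q + q := by ring
    omega
  unfold color
  split_ifs with h1 h2 h3
  · omega
  · omega
  · omega
  · refine lt_of_le_of_ne hle fun h => ?_
    rw [h, mul_comm] at hmod
    omega

theorem div_mod_of_mem {k p : ℕ} (h1 : k * q ≤ p) (h2 : p < (k + 1) * q) :
    p / q = k ∧ p % q = p - k * q := by
  have h : p / q = k := Nat.div_eq_of_lt_le h1 h2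
  have := Nat.div_add_mod p q
  rw [h, mul_comm] at this
  exact ⟨h, by omega⟩

/-- What the absence of the colour `k` in an edge means for the weights. -/
theorem of_color_ne {r k : ℕ} (hk : k < r) (hdq : d < q) {e : Finset V} (he : e ∈ E)
    (hc : ∀ u ∈ e, color E σ q d r u ≠ k) :
    (∀ u ∈ e, ¬ (k * q + d ≤ σ u ∧ σ u < (k + 1) * q)) ∧
      (∀ u ∈ e, k * q ≤ σ u → σ u < k * q + d → Low E σ q d k u) ∧
      ∀ u ∈ e, ¬ ((k + 1) * q ≤ σ u ∧ σ u < (k + 1) * q + d) := by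
  have e1 : (k + 1) * q = k * q + q := by ring
  have e2 : (k + 1 + 1) * q = k * q + q + q := by ring
  have A : ∀ u ∈ e, ¬ (k * q + d ≤ σ u ∧ σ u < (k + 1) * q) := by
    rintro u hu ⟨h1, h2⟩
    obtain ⟨h3, h4⟩ := div_mod_of_mem (q := q) (k := k) (by omega) h2
    apply hc u hu
    unfold color
    rw [if_neg (by omega), h3]
  have B : ∀ u ∈ e, k * q ≤ σ u → σ u < k * q + d → Low E σ q d k u := by
    intro u hu h1 h2
    obtain ⟨h3, h4⟩ := div_mod_of_mem (q := q) (k := k) h1 (by omega)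
    by_contra hl
    apply hc u hu
    unfold color
    rw [if_pos (by omega), h3, if_neg (by omega), if_neg hl]
  refine ⟨A, B, ?_⟩
  by_contra! hne
  obtain ⟨u₀, hu₀, h0⟩ := hne
  let s := e.filter fun u => (k + 1) * q ≤ σ u ∧ σ u < (k + 1) * q + d
  -- By `A` and `B`, `e` itself witnesses that its last vertex in this overlap is `Low`, so that
  -- vertex gets `k`. If `k + 1 = r`, the rule for the top overlap gives `k` directly.
  obtain ⟨v, hv, hmax⟩ := s.exists_max_image σ ⟨u₀, by simp [s, hu₀, h0]⟩
  simp only [s, mem_filter, and_imp] at hv hmax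
  obtain ⟨h3, h4⟩ := div_mod_of_mem (q := q) (k := k + 1) hv.2.1 (by omega)
  apply hc v hv.1
  unfold color
  rw [if_pos (by omega), h3]
  split_ifs with h5 h6
  · omega
  · omega
  · exact absurd ⟨e, he, hv.1, hmax, A, B⟩ h6

/-- The weights that the `k`-th edge of a chain of `l + 1` edges starting at the colour `j` avoids,
where `x m` is the weight of the vertex linking the edges `m` and `m + 1`. -/
def forbidden (q d j l : ℕ) (x : Fin l → ℕ) (k : Fin (l + 1)) : Finset ℕ :=
  -- The `cons` and `snoc` values make the bottom and top edges avoid the whole outer overlaps. The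
  -- `+ 1` is needed because the link lies in both of its edges.
  Ico ((j + k) * q) (Fin.cons (α := fun _ => ℕ) (j * q + d) x k) ∪
    (Ico ((j + k) * q + d) ((j + k + 1) * q) ∪
      Ico (Fin.snoc (α := fun _ => ℕ) (fun m => x m + 1) ((j + l + 1) * q) k)
        ((j + k + 1) * q + d))

/-- The weights in which the edges `e` form a chain with links `v` at the positions `x`. -/
def IsChain (σ : V → ℕ) (q d j l : ℕ) (e : Fin (l + 1) → Finset V) (v : Fin l → V)
    (x : Fin l → ℕ) : Prop :=
  (∀ m, σ (v m) = x m) ∧ ∀ k, ∀ u ∈ e k, σ u ∉ forbidden q d j l x k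

/-- A chain of edges ending in `e`, the top overlap of which is still unconstrained. -/
theorem exists_partial_chain (k : ℕ) (e : Finset V) (he : e ∈ E)
    (h1 : ∀ u ∈ e, ¬ (k * q + d ≤ σ u ∧ σ u < (k + 1) * q))
    (h2 : ∀ u ∈ e, k * q ≤ σ u → σ u < k * q + d → Low E σ q d k u) :
    ∃ j l, j + l = k ∧ ∃ (ee : Fin (l + 1) → Finset V) (v : Fin l → V),
      (∀ i, ee i ∈ E) ∧ ee (Fin.last l) = e ∧
      (∀ m : Fin l, v m ∈ ee m.castSucc ∧ v m ∈ ee m.succ ∧ (j + m + 1) * q ≤ σ (v m) ∧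
        σ (v m) < (j + m + 1) * q + d ∧
        (∀ u ∈ ee m.castSucc, (j + m + 1) * q ≤ σ u → σ u < (j + m + 1) * q + d → σ u ≤ σ (v m)) ∧
        (∀ u ∈ ee m.succ, (j + m + 1) * q ≤ σ u → σ u < (j + m + 1) * q + d → σ (v m) ≤ σ u)) ∧
      (∀ i : Fin (l + 1), ∀ u ∈ ee i, ¬ ((j + i) * q + d ≤ σ u ∧ σ u < (j + i + 1) * q)) ∧
      ∀ u ∈ ee 0, ¬ (j * q ≤ σ u ∧ σ u < j * q + d) := by
  induction k generalizing e with
  | zero =>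
    refine ⟨0, 0, rfl, fun _ => e, Fin.elim0, fun _ => he, rfl, fun m => m.elim0, ?_, ?_⟩
    · intro i u hu
      simpa using h1 u hu
    · rintro u hu ⟨h3, h4⟩
      exact h2 u hu h3 h4
  | succ k ih =>
    by_cases hemp : ∀ u ∈ e, ¬ ((k + 1) * q ≤ σ u ∧ σ u < (k + 1) * q + d)
    · refine ⟨k + 1, 0, rfl, fun _ => e, Fin.elim0, fun _ => he, rfl, fun m => m.elim0, ?_, hemp⟩
      intro i u hu
      simpa using h1 u hu
    · push Not at hemp
      obtain ⟨u₀, hu₀, h0⟩ := hemp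
      let s := e.filter fun u => (k + 1) * q ≤ σ u ∧ σ u < (k + 1) * q + d
      -- The first vertex of `e` in the overlap is `Low` because of an edge `e'` in which it is the
      -- last one. That edge satisfies the hypotheses one colour lower, so the chain continues
      -- downwards from it.
      obtain ⟨v, hv, hmin⟩ := s.exists_min_image σ ⟨u₀, by simp [s, hu₀, h0]⟩
      simp only [s, mem_filter, and_imp] at hv hmin
      obtain ⟨e', he', hve', hlast, h3, h4⟩ := h2 v hv.1 hv.2.1 hv.2.2
      obtain ⟨j, l, hjl, ee, vv, hE, htop, hlink, hmid, hbot⟩ := ih e' he' h3 h4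
      refine ⟨j, l + 1, by omega, Fin.snoc (α := fun _ => Finset V) ee e,
        Fin.snoc (α := fun _ => V) vv v, ?_, by simp, ?_, ?_, ?_⟩
      · intro i
        refine Fin.lastCases ?_ (fun i => ?_) i <;> simp [he, hE]
      · intro m
        refine Fin.lastCases ?_ (fun m => ?_) m
        · have : j + (Fin.last l : ℕ) + 1 = k + 1 := by simp; omega
          rw [this]
          simp only [Fin.snoc_last, Fin.snoc_castSucc, Fin.succ_last, htop]
          exact ⟨hve', hv.1, hv.2.1, hv.2.2, hlast, hmin⟩
        · rw [Fin.succ_castSucc]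
          simp only [Fin.snoc_castSucc, Fin.val_castSucc]
          exact hlink m
      · intro i
        refine Fin.lastCases ?_ (fun i => ?_) i
        · have : j + (Fin.last (l + 1) : ℕ) = k + 1 := by simp; omega
          rw [this]
          simpa using h1
        · simpa using hmid i
      · have : (0 : Fin (l + 1 + 1)) = (0 : Fin (l + 1)).castSucc := rfl
        rw [this, Fin.snoc_castSucc]
        exact hbot

/-- If an edge misses a colour, then there is a chain of edges. -/
theorem exists_chain {r k : ℕ} (hk : k < r) (hdq : d < q) {e : Finset V} (he : e ∈ E)
    (hc : ∀ u ∈ e, color E σ q d r u ≠ k) :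
    ∃ j l, j + l < r ∧ ∃ (ee : Fin (l + 1) → Finset V) (v : Fin l → V) (x : Fin l → ℕ),
      (∀ i, ee i ∈ E) ∧ (∀ m, v m ∈ ee m.castSucc ∧ v m ∈ ee m.succ) ∧
      (∀ m : Fin l, (j + m + 1) * q ≤ x m ∧ x m < (j + m + 1) * q + d) ∧
      IsChain σ q d j l ee v x := by
  obtain ⟨h1, h2, h3⟩ := of_color_ne hk hdq he hc
  obtain ⟨j, l, hjl, ee, v, hE, htop, hlink, hmid, hbot⟩ := exists_partial_chain k e he h1 h2
  refine ⟨j, l, by omega, ee, v, fun m => σ (v m), hE, fun m => ⟨(hlink m).1, (hlink m).2.1⟩,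
    fun m => ⟨(hlink m).2.2.1, (hlink m).2.2.2.1⟩, fun _ => rfl, ?_⟩
  intro i u hu hmem
  simp only [forbidden, mem_union, mem_Ico] at hmem
  rcases hmem with h | h | h
  · revert hu h
    refine Fin.cases ?_ (fun m => ?_) i
    · intro hu h
      simp only [Fin.val_zero, add_zero, Fin.cons_zero] at h
      exact hbot u hu h
    · intro hu h
      simp only [Fin.val_succ, Fin.cons_succ, ← add_assoc] at h
      have := (hlink m).2.2.2.2.2 u hu h.1 (h.2.trans (hlink m).2.2.2.1)
      omega
  · exact hmid i u hu h
  · revert hu h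
    refine Fin.lastCases ?_ (fun m => ?_) i
    · intro hu h
      rw [htop] at hu
      simp only [Fin.snoc_last, Fin.val_last] at h
      rw [hjl] at h
      exact h3 u hu h
    · intro hu h
      simp only [Fin.snoc_castSucc, Fin.val_castSucc] at h
      have := (hlink m).2.2.2.2.1 u hu (by have := (hlink m).2.2.1; omega) h.2
      omega

end Coloring

/-! ### Sizes and disjointness of the avoided weights -/

theorem cons_link_mem {q d j l : ℕ} {x : Fin l → ℕ}
    (hx : ∀ m : Fin l, (j + m + 1) * q ≤ x m ∧ x m < (j + m + 1) * q + d) (k : Fin (l + 1)) :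
    (j + k) * q ≤ Fin.cons (α := fun _ => ℕ) (j * q + d) x k ∧
      Fin.cons (α := fun _ => ℕ) (j * q + d) x k ≤ (j + k) * q + d := by
  refine Fin.cases ?_ (fun m => ?_) k
  · simp
  · simp only [Fin.val_succ, Fin.cons_succ, ← add_assoc]
    exact ⟨(hx m).1, (hx m).2.le⟩

theorem snoc_link_mem {q d j l : ℕ} {x : Fin l → ℕ}
    (hx : ∀ m : Fin l, (j + m + 1) * q ≤ x m ∧ x m < (j + m + 1) * q + d) (k : Fin (l + 1)) :
    (j + k + 1) * q ≤ Fin.snoc (α := fun _ => ℕ) (fun m => x m + 1) ((j + l + 1) * q) k ∧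
      Fin.snoc (α := fun _ => ℕ) (fun m => x m + 1) ((j + l + 1) * q) k ≤
        (j + k + 1) * q + d := by
  refine Fin.lastCases ?_ (fun m => ?_) k
  · simp
  · simp only [Fin.snoc_castSucc, Fin.val_castSucc]
    have := hx m
    omega

theorem card_forbidden {q d j l : ℕ} {x : Fin l → ℕ} (hdq : d < q)
    (hx : ∀ m : Fin l, (j + m + 1) * q ≤ x m ∧ x m < (j + m + 1) * q + d) (k : Fin (l + 1)) :
    ((#(forbidden q d j l x k) : ℕ) : ℝ) =
        (Fin.cons (α := fun _ => ℕ) (j * q + d) x k : ℕ) -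
        (Fin.snoc (α := fun _ => ℕ) (fun m => x m + 1) ((j + l + 1) * q) k : ℕ) + 2 * q ∧
      #(forbidden q d j l x k) ≤ q + d ∧ q ≤ #(forbidden q d j l x k) + d := by
  have hlo := cons_link_mem hx k
  have hhi := snoc_link_mem hx k
  unfold forbidden
  generalize Fin.cons (α := fun _ => ℕ) (j * q + d) x k = lo at *
  generalize Fin.snoc (α := fun _ => ℕ) (fun m => x m + 1) ((j + l + 1) * q) k = hi at *
  have e1 : (j + k + 1) * q = (j + k) * q + q := by ring
  rw [e1] at hhi ⊢
  generalize (j + (k : ℕ)) * q = b at *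
  have h1 : Disjoint (Ico (b + d) (b + q)) (Ico hi (b + q + d)) := by
    rw [disjoint_left]; intro p; simp only [mem_Ico]; omega
  have h2 : Disjoint (Ico b lo) (Ico (b + d) (b + q) ∪ Ico hi (b + q + d)) := by
    rw [disjoint_left]; intro p; simp only [mem_Ico, mem_union]; omega
  rw [card_union_of_disjoint h2, card_union_of_disjoint h1]
  simp only [Nat.card_Ico]
  refine ⟨?_, by omega, by omega⟩
  have : ((lo - b + (b + q - (b + d) + (b + q + d - hi)) : ℕ) : ℤ) = lo - hi + 2 * q := by omega
  exact_mod_cast this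

/-- Each `x m` ends one interval and `x m + 1` starts another, so the sum telescopes with a loss of
one per link. -/
theorem sum_card_forbidden {q d j l : ℕ} {x : Fin l → ℕ} (hdq : d < q)
    (hx : ∀ m : Fin l, (j + m + 1) * q ≤ x m ∧ x m < (j + m + 1) * q + d) :
    ∑ k, ((#(forbidden q d j l x k) : ℕ) : ℝ) = (l + 1) * q + d - l := by
  rw [sum_congr rfl fun k _ => (card_forbidden hdq hx k).1, sum_add_distrib, sum_sub_distrib,
    Fin.sum_univ_succ]
  conv_lhs => enter [1, 2]; rw [Fin.sum_univ_castSucc]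
  simp only [Fin.cons_zero, Fin.cons_succ, Fin.snoc_castSucc, Fin.snoc_last]
  push_cast
  rw [sum_add_distrib]
  simp
  ring

theorem forbidden_subset {q d j l r : ℕ} {x : Fin l → ℕ} (hj : j + l < r)
    (hx : ∀ m : Fin l, (j + m + 1) * q ≤ x m ∧ x m < (j + m + 1) * q + d) (k : Fin (l + 1)) :
    forbidden q d j l x k ⊆ range (r * q + d) := by
  have h : (j + k + 1) * q ≤ r * q := Nat.mul_le_mul_right _ (by omega)
  have e1 : (j + k + 1) * q = (j + k) * q + q := by ring
  intro p hp
  simp only [forbidden, mem_union, mem_Ico, mem_range] at hp ⊢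
  rcases hp with hp | hp | hp
  · revert hp h e1
    refine Fin.cases ?_ (fun m => ?_) k
    · simp only [Fin.val_zero, add_zero, Fin.cons_zero]
      omega
    · simp only [Fin.val_succ, Fin.cons_succ, ← add_assoc]
      have := hx m
      omega
  · omega
  · omega

/-- Only consecutive sets reach a common overlap; there the lower edge avoids weights above the link
and the upper edge those below it. -/
theorem disjoint_forbidden_of_lt {q d j l : ℕ} {x : Fin l → ℕ} (hdq : d < q)
    (hx : ∀ m : Fin l, (j + m + 1) * q ≤ x m ∧ x m < (j + m + 1) * q + d) {k k' : Fin (l + 1)}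
    (hk : k < k') : Disjoint (forbidden q d j l x k) (forbidden q d j l x k') := by
  rw [disjoint_left]
  intro p
  simp only [forbidden, mem_union, mem_Ico]
  have hk' : (k : ℕ) < k' := hk
  revert hk'
  refine Fin.lastCases (fun hk' => ?_) (fun m => ?_) k
  · have := k'.2
    simp at hk'
    omega
  · refine Fin.cases (fun hk' => ?_) (fun m' => ?_) k'
    · simp at hk'
    · simp only [Fin.val_succ, Fin.cons_succ, Fin.snoc_castSucc, Fin.val_castSucc]
      intro hk'
      have hm := hx m
      have hm' := hx m'
      have hlo := cons_link_mem hx m.castSucc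
      have hhi := snoc_link_mem hx m'.succ
      simp only [Fin.val_castSucc, Fin.val_succ, ← add_assoc] at hlo hhi
      simp only [← add_assoc]
      have e1 : (j + m + 1) * q = (j + m) * q + q := by ring
      have e2 : (j + m' + 1 + 1) * q = (j + m' + 1) * q + q := by ring
      rcases (show (m : ℕ) ≤ m' by omega).eq_or_lt with h | h
      · obtain rfl : m = m' := Fin.ext h
        omega
      · have h5 : (j + m + 1 + 1) * q ≤ (j + m' + 1) * q := Nat.mul_le_mul_right _ (by omega)
        have e3 : (j + m + 1 + 1) * q = (j + m + 1) * q + q := by ring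
        have h6 : p < (j + m + 1) * q + d → (j + m' + 1) * q ≤ p → False := by omega
        omega

/-! ### Inequalities behind the gain from intersections -/

/-- An upper bound for the measure of the complement of disjoint sets in terms of the product of
the measures of the complements, with a gain for every pair of consecutive sets. -/
theorem one_sub_sum_le_prod {l : ℕ} (S : Fin (l + 1) → Prop) [DecidablePred S]
    (f : Fin (l + 1) → ℝ) {φ : ℝ} (hφ : 0 ≤ φ) (hφ1 : φ ≤ 1) (hf : ∀ k, φ ≤ f k)
    (hf1 : ∀ k, f k ≤ 1) :
    1 - ∑ k, (if S k then f k else 0) ≤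
      (∏ k, if S k then 1 - f k else 1) *
        ∏ m : Fin l, if S m.castSucc ∧ S m.succ then 1 - φ ^ 2 else 1 := by
  have hθ : 0 ≤ 1 - φ ^ 2 := by nlinarith
  induction l with
  | zero => by_cases h : S 0 <;> simp [h]
  | succ l ih =>
    have IH := ih (fun k => S k.castSucc) (fun k => f k.castSucc) (fun k => hf _) (fun k => hf1 _)
    rw [Fin.sum_univ_castSucc, Fin.prod_univ_castSucc (n := l),
      Fin.prod_univ_castSucc (n := l + 1)]
    simp only [Fin.succ_castSucc]
    rw [Fin.succ_last]
    set T := ∑ k : Fin (l + 1), (if S k.castSucc then f k.castSucc else 0) with hT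
    set P := ∏ k : Fin (l + 1), (if S k.castSucc then 1 - f k.castSucc else 1) with hP
    set Q := ∏ m : Fin l, (if S m.castSucc.castSucc ∧ S m.succ.castSucc then 1 - φ ^ 2 else 1)
      with hQ
    have hT0 : 0 ≤ T := sum_nonneg fun k _ => by
      split_ifs
      · exact hφ.trans (hf _)
      · exact le_rfl
    have hP0 : 0 ≤ P := prod_nonneg fun k _ => by
      split_ifs
      · linarith [hf1 k.castSucc]
      · exact zero_le_one
    have hQ0 : 0 ≤ Q := prod_nonneg fun k _ => by
      split_ifs
      · exact hθ
      · exact zero_le_one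
    have hPQ := mul_nonneg hP0 hQ0
    set b := f (Fin.last (l + 1)) with hb
    have hbφ : φ ≤ b := hf _
    have hb1 : b ≤ 1 := hf1 _
    by_cases h1 : S (Fin.last (l + 1))
    · simp only [h1, and_true, if_true]
      by_cases h2 : S (Fin.last l).castSucc
      · simp only [h2, if_true]
        have hTφ : φ ≤ T := by
          have := single_le_sum (f := fun k : Fin (l + 1) =>
            if S k.castSucc then f k.castSucc else 0) (s := univ) (fun k _ => by
              split_ifs
              · exact hφ.trans (hf _)
              · exact le_rfl) (mem_univ (Fin.last l))
          simp only [h2, if_true] at this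
          exact (hf _).trans this
        -- Since `(1 - T) * (1 - b)` exceeds the left side by `T * b ≥ φ ^ 2` and is at most `1`,
        -- the factor `1 - φ ^ 2` is affordable. If `1 ≤ T`, the left side is nonpositive anyway.
        have h3 : 1 - (T + b) ≤ (1 - T) * (1 - b) * (1 - φ ^ 2) ∨ 1 ≤ T := by
          by_cases hT1 : 1 ≤ T
          · exact Or.inr hT1
          · left
            push Not at hT1
            have h4 : 0 ≤ (1 - T) * (1 - b) := mul_nonneg (by linarith) (by linarith)
            have h5 : (1 - T) * (1 - b) ≤ 1 := mul_le_one₀ (by linarith) (by linarith) (by linarith)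
            have h6 : φ ^ 2 ≤ T * b := by rw [sq]; exact mul_le_mul hTφ hbφ hφ hT0
            nlinarith [mul_le_mul h5 h6 (sq_nonneg φ) zero_le_one]
        rcases h3 with h3 | h3
        · calc 1 - (T + b) ≤ (1 - T) * (1 - b) * (1 - φ ^ 2) := h3
            _ ≤ (P * Q) * (1 - b) * (1 - φ ^ 2) := by
                have : 0 ≤ 1 - b := by linarith
                gcongr
            _ = _ := by ring
        · have h7 : 0 ≤ (P * (1 - b)) * (Q * (1 - φ ^ 2)) :=
            mul_nonneg (mul_nonneg hP0 (by linarith)) (mul_nonneg hQ0 hθ)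
          linarith [hφ.trans hbφ]
      · simp only [h2, if_false, mul_one]
        have h8 : (1 - T) * (1 - b) ≤ P * Q * (1 - b) :=
          mul_le_mul_of_nonneg_right IH (by linarith)
        nlinarith [mul_nonneg hT0 (hφ.trans hbφ)]
    · simpa [h1] using IH

/-- Each of the first `m` terms of the geometric series is at least `θ ^ m`. -/
theorem mul_pow_le_inv {θ : ℝ} (h0 : 0 ≤ θ) (h1 : θ < 1) (m : ℕ) : m * θ ^ m ≤ (1 - θ)⁻¹ := by
  have h2 : (m : ℝ) * θ ^ m ≤ ∑ i ∈ range m, θ ^ i := by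
    have := card_nsmul_le_sum (range m) (fun i => θ ^ i) (θ ^ m) fun i hi =>
      pow_le_pow_of_le_one h0 h1.le (mem_range.1 hi).le
    simpa using this
  have h3 := geom_sum_mul θ m
  have h4 : 0 ≤ θ ^ m := pow_nonneg h0 m
  have h5 : 0 < 1 - θ := by linarith
  rw [← one_div, le_div_iff₀ h5]
  nlinarith [mul_le_mul_of_nonneg_right h2 h5.le]

/-! ### Counting the weightings that realise a chain -/

section Count

variable {V : Type*} [Fintype V] [DecidableEq V]

/-- The number of weight functions for which given vertices have given weights and the vertices of
given edges avoid given sets. -/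
theorem card_chain_le {N n l : ℕ} (hN : 0 < N) (F : Fin (l + 1) → Finset ℕ)
    (hsub : ∀ k, F k ⊆ range N) (hdisj : ∀ k k', k ≠ k' → Disjoint (F k) (F k'))
    (x : Fin l → ℕ) (hx : Function.Injective x) (e : Fin (l + 1) → Finset V)
    (he : ∀ k, #(e k) = n) (v : Fin l → V) {φ A K : ℝ} (hφ : 0 ≤ φ) (hφ1 : φ ≤ 1) (hA : 0 ≤ A)
    (hA1 : A ≤ 1) (hf : ∀ k, φ ≤ #(F k) / N) (hfA : ∀ k, A ≤ 1 - #(F k) / N)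
    (hK : 1 ≤ K * (A * (1 - φ ^ 2)) ^ (l + 1)) (hK0 : 0 ≤ K) :
    (#{σ ∈ Fintype.piFinset fun _ : V => range N |
        (∀ m, σ (v m) = x m) ∧ ∀ k, ∀ u ∈ e k, σ u ∉ F k} : ℝ) ≤
      N ^ Fintype.card V * (K / N) ^ l * (∏ k, (1 - #(F k) / N : ℝ)) ^ n *
        ∏ m : Fin l, (1 - φ ^ 2) ^ #(e m.castSucc ∩ e m.succ) := by
  have hN' : (0 : ℝ) < N := by exact_mod_cast hN
  have hθ : 0 ≤ 1 - φ ^ 2 := by nlinarith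
  have hθ1 : 1 - φ ^ 2 ≤ 1 := by nlinarith
  have ha0 : ∀ k, 0 ≤ 1 - (#(F k) : ℝ) / N := fun k => hA.trans (hfA k)
  by_cases hv : Function.Injective v
  swap
  · rw [filter_false_of_mem, card_empty]
    · have h1 : 0 ≤ ∏ k, (1 - #(F k) / N : ℝ) := prod_nonneg fun k _ => ha0 k
      have h2 : 0 ≤ ∏ m : Fin l, (1 - φ ^ 2) ^ #(e m.castSucc ∩ e m.succ) :=
        prod_nonneg fun k _ => pow_nonneg hθ _
      push_cast
      positivity
    · rintro σ - ⟨h1, -⟩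
      refine hv fun m m' hm => hx ?_
      rw [← h1, ← h1, hm]
  -- The vertices are independent: the event is a product of sets `B u` of admissible weights, and
  -- `w u` bounds the density of `B u` when `u` is not a link.
  let B : V → Finset ℕ := fun u =>
    {p ∈ range N | (∀ m, v m = u → p = x m) ∧ ∀ k, u ∈ e k → p ∉ F k}
  let w : V → ℝ := fun u => (∏ k, if u ∈ e k then 1 - (#(F k) : ℝ) / N else 1) *
    ∏ m : Fin l, if u ∈ e m.castSucc ∧ u ∈ e m.succ then 1 - φ ^ 2 else 1
  have hfilter : {σ ∈ Fintype.piFinset fun _ : V => range N |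
      (∀ m, σ (v m) = x m) ∧ ∀ k, ∀ u ∈ e k, σ u ∉ F k} = Fintype.piFinset B := by
    ext σ
    simp only [mem_filter, Fintype.mem_piFinset, B]
    constructor
    · rintro ⟨h1, h2, h3⟩ u
      exact ⟨h1 u, fun m hm => hm ▸ h2 m, fun k hk => h3 k u hk⟩
    · intro h
      exact ⟨fun u => (h u).1, fun m => (h (v m)).2.1 m rfl, fun k u hu => (h u).2.2 k hu⟩
  -- A link has at most one admissible weight. Bounding `1` by `K * w u` keeps the factor `w u`
  -- there too, at a cost of `K / N` per link.
  have hw : ∀ u, 1 ≤ K * w u := by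
    intro u
    refine hK.trans (mul_le_mul_of_nonneg_left ?_ hK0)
    rw [mul_pow]
    refine mul_le_mul ?_ ?_ (pow_nonneg hθ _) (prod_nonneg fun k _ => ?_)
    · have := prod_le_prod (s := (univ : Finset (Fin (l + 1)))) (f := fun _ => A)
        (g := fun k => if u ∈ e k then 1 - (#(F k) : ℝ) / N else 1) (fun _ _ => hA) (fun k _ => by
          split_ifs
          exacts [hfA k, hA1])
      simpa using this
    · have := prod_le_prod (s := (univ : Finset (Fin l))) (f := fun _ => 1 - φ ^ 2)
        (g := fun m => if u ∈ e m.castSucc ∧ u ∈ e m.succ then 1 - φ ^ 2 else 1) (fun _ _ => hθ)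
        (fun k _ => by
          split_ifs
          exacts [le_rfl, hθ1])
      refine (pow_le_pow_of_le_one hθ hθ1 (Nat.le_succ l)).trans ?_
      simpa using this
    · split_ifs
      exacts [ha0 k, zero_le_one]
  have hw0 : ∀ u, 0 ≤ w u := by
    intro u
    by_contra! h
    have := mul_nonpos_of_nonneg_of_nonpos hK0 h.le
    linarith [hw u]
  have hB : ∀ u, (#(B u) : ℝ) ≤ N * w u * if u ∈ univ.image v then K / N else 1 := by
    intro u
    split_ifs with hu
    · obtain ⟨m, -, rfl⟩ := mem_image.1 hu
      have h1 : #(B (v m)) ≤ 1 := by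
        rw [card_le_one]
        intro p hp p' hp'
        simp only [B, mem_filter] at hp hp'
        rw [hp.2.1 m rfl, hp'.2.1 m rfl]
      have h2 : (N : ℝ) * w (v m) * (K / N) = K * w (v m) := by field_simp
      rw [h2]
      exact le_trans (by exact_mod_cast h1) (hw _)
    · rw [mul_one]
      let U := (univ.filter fun k => u ∈ e k).biUnion F
      have hUs : U ⊆ range N := biUnion_subset.2 fun k _ => hsub k
      have h1 : #(B u) ≤ N - #U := by
        have : B u ⊆ range N \ U := by
          intro p hp
          simp only [B, mem_filter] at hp
          simp only [mem_sdiff, U, mem_biUnion, mem_filter, mem_univ, true_and, not_exists, not_and]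
          exact ⟨hp.1, hp.2.2⟩
        have h2 := card_le_card this
        rwa [card_sdiff_of_subset hUs, card_range] at h2
      have h2 : #U = ∑ k, if u ∈ e k then #(F k) else 0 := by
        rw [card_biUnion fun k _ k' _ h => hdisj k k' h, sum_filter]
      have h3 : #U ≤ N := by simpa using card_le_card hUs
      have h4 : (#(B u) : ℝ) ≤ N - #U := by
        rw [← Nat.cast_sub h3]; exact_mod_cast h1
      have h5 := one_sub_sum_le_prod (fun k => u ∈ e k) (fun k => (#(F k) : ℝ) / N) hφ hφ1 hf
        (fun k => by linarith [ha0 k])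
      have h6 : (N : ℝ) - #U = N * (1 - ∑ k, if u ∈ e k then (#(F k) : ℝ) / N else 0) := by
        rw [h2, mul_sub, mul_one, mul_sum]
        push_cast
        congr 1
        refine sum_congr rfl fun k _ => ?_
        split_ifs
        · field_simp
        · simp
      rw [h6] at h4
      exact h4.trans (mul_le_mul_of_nonneg_left h5 hN'.le)
  rw [hfilter, Fintype.card_piFinset]
  push_cast
  refine (prod_le_prod (fun _ _ => by positivity) fun u _ => hB u).trans (le_of_eq ?_)
  rw [prod_mul_distrib, prod_mul_distrib, prod_ite_mem, univ_inter, prod_const, prod_const,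
    card_univ, card_image_of_injective _ hv, card_univ, Fintype.card_fin]
  have h7 : ∏ u, w u = (∏ k, (1 - #(F k) / N : ℝ)) ^ n *
      ∏ m : Fin l, (1 - φ ^ 2) ^ #(e m.castSucc ∩ e m.succ) := by
    simp only [w]
    rw [prod_mul_distrib, prod_comm, prod_comm (s := univ) (t := (univ : Finset (Fin l))),
      ← prod_pow]
    congr 1
    · refine prod_congr rfl fun k _ => ?_
      rw [prod_ite_mem, univ_inter, prod_const, he]
    · refine prod_congr rfl fun m _ => ?_
      simp_rw [← mem_inter]
      rw [prod_ite_mem, univ_inter, prod_const]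
  rw [h7]
  ring

/-- The number of weight functions for which a given sequence of edges forms a chain. -/
theorem sum_card_chain_le {n q d j l r : ℕ} (hdq : d < q) (hj : j + l < r)
    (e : Fin (l + 1) → Finset V) (he : ∀ k, #(e k) = n) {φ A K D : ℝ} (hφ : 0 < φ) (hφ1 : φ ≤ 1)
    (hA : 0 ≤ A) (hA1 : A ≤ 1) (hf : φ * (r * q + d : ℕ) ≤ q - d)
    (hfA : (q + d : ℝ) ≤ (1 - A) * (r * q + d : ℕ))
    (hK : 1 ≤ K * (A * (1 - φ ^ 2)) ^ (l + 1)) (hK0 : 0 ≤ K)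
    (hD : ∀ f : Fin (l + 1) → ℝ, (∀ k, f k ≤ 1) →
      ∑ k, f k = ((l + 1) * q + d - l) / (r * q + d : ℕ) → (∏ k, (1 - f k)) ^ n ≤ D) :
    (∑ v ∈ Fintype.piFinset fun m : Fin l => e m.castSucc ∩ e m.succ,
      ∑ x ∈ Fintype.piFinset fun m : Fin l => Ico ((j + m + 1) * q) ((j + m + 1) * q + d),
        #{σ ∈ Fintype.piFinset fun _ : V => range (r * q + d) |
          (∀ m, σ (v m) = x m) ∧ ∀ k, ∀ u ∈ e k, σ u ∉ forbidden q d j l x k} : ℝ) ≤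
      ((r * q + d : ℕ) : ℝ) ^ Fintype.card V * (d * K / ((r * q + d : ℕ) * φ ^ 2)) ^ l * D := by
  set N := r * q + d with hN
  have hNpos : 0 < N := by
    have : 0 < r * q := Nat.mul_pos (by omega) (by omega)
    omega
  have hN' : (0 : ℝ) < N := by exact_mod_cast hNpos
  have hθ : 0 ≤ 1 - φ ^ 2 := by nlinarith
  have hθ1 : 1 - φ ^ 2 < 1 := by nlinarith
  have hD0 : 0 ≤ D := by
    -- `0 ≤ D` follows from `hD` with all `f k` equal.
    let c : ℝ := ((l + 1) * q + d - l) / N / (l + 1 : ℕ)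
    have hc : c ≤ 1 := by
      have hjr : (l + 1) * q ≤ r * q := Nat.mul_le_mul_right _ (by omega)
      have hjr' : ((l : ℝ) + 1) * q + d ≤ N := by rw [hN]; exact_mod_cast Nat.add_le_add_right hjr d
      have h1 : ((l + 1) * q + d - l) / N ≤ (1 : ℝ) := by
        rw [div_le_one hN']
        have : (0 : ℝ) ≤ l := by positivity
        linarith
      simp only [c]
      rw [div_le_one (by positivity)]
      refine h1.trans ?_
      push_cast
      have : (0 : ℝ) ≤ l := by positivity
      linarith
    refine le_trans ?_ (hD (fun _ => c) (fun _ => hc) ?_)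
    · exact pow_nonneg (prod_nonneg fun _ _ => by linarith) _
    · rw [sum_const, card_univ, Fintype.card_fin, nsmul_eq_mul]
      simp only [c]
      field_simp
  have hterm : ∀ v : Fin l → V, ∀ x ∈ Fintype.piFinset fun m : Fin l =>
      Ico ((j + m + 1) * q) ((j + m + 1) * q + d),
      (#{σ ∈ Fintype.piFinset fun _ : V => range N |
          (∀ m, σ (v m) = x m) ∧ ∀ k, ∀ u ∈ e k, σ u ∉ forbidden q d j l x k} : ℝ) ≤
      N ^ Fintype.card V * (K / N) ^ l * D *
        ∏ m : Fin l, (1 - φ ^ 2) ^ #(e m.castSucc ∩ e m.succ) := by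
    intro v x hx
    simp only [Fintype.mem_piFinset, mem_Ico] at hx
    have hfA' : ∀ k, A ≤ 1 - (#(forbidden q d j l x k) : ℝ) / N := by
      intro k
      have h1 : (#(forbidden q d j l x k) : ℝ) ≤ q + d := by
        exact_mod_cast (card_forbidden hdq hx k).2.1
      rw [le_sub_comm, div_le_iff₀ hN']
      exact h1.trans hfA
    refine (card_chain_le hNpos _ (forbidden_subset hj hx) ?_ x ?_ e he v hφ.le hφ1 hA hA1 ?_
      hfA' hK hK0).trans ?_
    · intro k k' hk
      rcases lt_or_gt_of_ne hk with h | h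
      · exact disjoint_forbidden_of_lt hdq hx h
      · exact (disjoint_forbidden_of_lt hdq hx h).symm
    · refine StrictMono.injective fun m m' hm => ?_
      have h1 : (j + m + 1 + 1) * q ≤ (j + m' + 1) * q :=
        Nat.mul_le_mul_right _ (by have : (m : ℕ) < m' := hm; omega)
      have e1 : (j + m + 1 + 1) * q = (j + m + 1) * q + q := by ring
      have := hx m
      have := hx m'
      omega
    · intro k
      have h1 : (q : ℝ) ≤ #(forbidden q d j l x k) + d := by
        exact_mod_cast (card_forbidden hdq hx k).2.2
      rw [le_div_iff₀ hN']
      linarith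
    · have h0 : 0 ≤ ∏ m : Fin l, (1 - φ ^ 2) ^ #(e m.castSucc ∩ e m.succ) :=
        prod_nonneg fun k _ => pow_nonneg hθ _
      have hD' := hD (fun k => (#(forbidden q d j l x k) : ℝ) / N)
        (fun k => by linarith [hfA' k]) (by rw [← sum_div, sum_card_forbidden hdq hx])
      gcongr
  refine (sum_le_sum fun v _ => sum_le_sum fun x hx => hterm v x hx).trans ?_
  simp only [sum_const, Fintype.card_piFinset, Nat.card_Ico, add_tsub_cancel_left, prod_const,
    card_univ, Fintype.card_fin, nsmul_eq_mul]
  push_cast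
  have h1 : (∏ m : Fin l, (#(e m.castSucc ∩ e m.succ) : ℝ)) *
      ∏ m : Fin l, (1 - φ ^ 2) ^ #(e m.castSucc ∩ e m.succ) ≤ ((φ ^ 2)⁻¹) ^ l := by
    rw [← prod_mul_distrib]
    have := prod_le_prod (s := (univ : Finset (Fin l)))
      (f := fun m => (#(e m.castSucc ∩ e m.succ) : ℝ) *
        (1 - φ ^ 2) ^ #(e m.castSucc ∩ e m.succ)) (g := fun _ => (φ ^ 2)⁻¹)
      (fun _ _ => by positivity) (fun m _ => by
        simpa using mul_pow_le_inv hθ hθ1 #(e m.castSucc ∩ e m.succ))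
    simpa using this
  calc _ = (N : ℝ) ^ Fintype.card V * (d * K / N) ^ l * D *
        ((∏ m : Fin l, (#(e m.castSucc ∩ e m.succ) : ℝ)) *
        ∏ m : Fin l, (1 - φ ^ 2) ^ #(e m.castSucc ∩ e m.succ)) := by
        rw [mul_div_assoc, mul_pow]; ring
    _ ≤ (N : ℝ) ^ Fintype.card V * (d * K / N) ^ l * D * ((φ ^ 2)⁻¹) ^ l := by gcongr
    _ = _ := by rw [mul_right_comm, mul_assoc _ (_ ^ l) (_ ^ l), ← mul_pow]; congr 3; field_simp

end Count

/-! ### The union bound -/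

/-- If no colouring worked, chains would cover all weightings; but there are at most `r ^ 2` pairs
`(j, l)`, each covering a fraction below `1 / r ^ 2`. -/
theorem exists_coloring_of_term_le {V : Type*} [Fintype V] [DecidableEq V] {q d r : ℕ}
    (hr : 0 < r) (hdq : d < q) (E : Finset (Finset V)) (T : ℕ → ℝ)
    (hterm : ∀ j l, j + l < r → ∀ e : Fin (l + 1) → Finset V, (∀ k, e k ∈ E) →
      (∑ v ∈ Fintype.piFinset fun m : Fin l => e m.castSucc ∩ e m.succ,
      ∑ x ∈ Fintype.piFinset fun m : Fin l => Ico ((j + m + 1) * q) ((j + m + 1) * q + d),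
        #{σ ∈ Fintype.piFinset fun _ : V => range (r * q + d) |
          (∀ m, σ (v m) = x m) ∧ ∀ k, ∀ u ∈ e k, σ u ∉ forbidden q d j l x k} : ℝ) ≤
      ((r * q + d : ℕ) : ℝ) ^ Fintype.card V * T l)
    (hT : ∀ l < r, (#E : ℝ) ^ (l + 1) * T l < 1 / (r : ℝ) ^ 2) :
    ∃ c : V → ℕ, (∀ v, c v < r) ∧ ∀ e ∈ E, ∀ k < r, ∃ u ∈ e, c u = k := by
  set N := r * q + d with hN
  have hNpos : 0 < N := by
    have : 0 < r * q := Nat.mul_pos (by omega) (by omega)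
    omega
  set Ω := Fintype.piFinset fun _ : V => range N with hΩ
  by_contra! hcon
  let B : ∀ (j l : ℕ) (e : Fin (l + 1) → Finset V) (v : Fin l → V) (x : Fin l → ℕ),
      Finset (V → ℕ) := fun j l e v x =>
    {σ ∈ Ω | (∀ m, σ (v m) = x m) ∧ ∀ k, ∀ u ∈ e k, σ u ∉ forbidden q d j l x k}
  let C : ∀ (j l : ℕ) (e : Fin (l + 1) → Finset V), Finset (V → ℕ) := fun j l e =>
    (Fintype.piFinset fun m : Fin l => e m.castSucc ∩ e m.succ).biUnion fun v =>
      (Fintype.piFinset fun m : Fin l =>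
        Ico ((j + m + 1) * q) ((j + m + 1) * q + d)).biUnion fun x => B j l e v x
  let I : Finset (ℕ × ℕ) := {p ∈ range r ×ˢ range r | p.1 + p.2 < r}
  have hcover : Ω ⊆ I.biUnion fun p =>
      (Fintype.piFinset fun _ : Fin (p.2 + 1) => E).biUnion fun e => C p.1 p.2 e := by
    intro σ hσ
    have hσ' : ∀ v, σ v < N := fun v => by simpa [hΩ] using Fintype.mem_piFinset.1 hσ v
    obtain ⟨e, he, k, hk, hc⟩ := hcon (color E σ q d r) fun v => color_lt hr (hσ' v) hdq
    obtain ⟨j, l, hjl, ee, v, x, hE, hv, hx, hch⟩ := exists_chain hk hdq he hc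
    simp only [mem_biUnion, C, B, I, mem_filter, mem_product, mem_range, Fintype.mem_piFinset,
      mem_inter, mem_Ico]
    exact ⟨(j, l), ⟨⟨by omega, by omega⟩, hjl⟩, ee, hE, v, hv, x, hx, hσ, hch⟩
  have hC : ∀ j l, j + l < r → ∀ e : Fin (l + 1) → Finset V, (∀ k, e k ∈ E) →
      (#(C j l e) : ℝ) ≤ (N : ℝ) ^ Fintype.card V * T l := by
    intro j l hjl e he
    refine le_trans ?_ (hterm j l hjl e he)
    have h1 : #(C j l e) ≤ ∑ v ∈ Fintype.piFinset fun m : Fin l => e m.castSucc ∩ e m.succ,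
        ∑ x ∈ Fintype.piFinset fun m : Fin l => Ico ((j + m + 1) * q) ((j + m + 1) * q + d),
          #(B j l e v x) :=
      card_biUnion_le.trans (sum_le_sum fun v _ => card_biUnion_le)
    exact_mod_cast h1
  have hNV : (0 : ℝ) < (N : ℝ) ^ Fintype.card V := by positivity
  have hr' : (0 : ℝ) < r := by exact_mod_cast hr
  have h1 : (#Ω : ℝ) ≤ ∑ p ∈ I, (#E : ℝ) ^ (p.2 + 1) * ((N : ℝ) ^ Fintype.card V * T p.2) := by
    have h2 : (#Ω : ℝ) ≤ ∑ p ∈ I, ∑ e ∈ Fintype.piFinset fun _ : Fin (p.2 + 1) => E,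
        (#(C p.1 p.2 e) : ℝ) := by
      exact_mod_cast (card_le_card hcover).trans
        (card_biUnion_le.trans (sum_le_sum fun p _ => card_biUnion_le))
    refine h2.trans (sum_le_sum fun p hp => ?_)
    refine (sum_le_sum fun e he => hC p.1 p.2 (mem_filter.1 hp).2 e
      (Fintype.mem_piFinset.1 he)).trans (le_of_eq ?_)
    rw [sum_const, Fintype.card_piFinset_const, nsmul_eq_mul]
    push_cast
    rfl
  have hcardΩ : (#Ω : ℝ) = (N : ℝ) ^ Fintype.card V := by
    rw [hΩ, Fintype.card_piFinset, prod_const, card_range, card_univ]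
    push_cast
    rfl
  have hI : I.Nonempty := ⟨(0, 0), by simp [I, hr]⟩
  have h2 : ∑ p ∈ I, (#E : ℝ) ^ (p.2 + 1) * ((N : ℝ) ^ Fintype.card V * T p.2) <
      ∑ p ∈ I, (N : ℝ) ^ Fintype.card V * (1 / (r : ℝ) ^ 2) := by
    refine sum_lt_sum_of_nonempty hI fun p hp => ?_
    rw [mul_left_comm]
    have hp2 := hT p.2 (by have := (mem_filter.1 hp).2; omega)
    gcongr
  have h3 : (#I : ℝ) ≤ (r : ℝ) ^ 2 := by
    have : #I ≤ r * r := (card_filter_le _ _).trans (by simp)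
    rw [sq]
    exact_mod_cast this
  rw [sum_const, nsmul_eq_mul] at h2
  have h4 : (#I : ℝ) * ((N : ℝ) ^ Fintype.card V * (1 / (r : ℝ) ^ 2)) ≤
      (N : ℝ) ^ Fintype.card V := by
    calc _ ≤ (r : ℝ) ^ 2 * ((N : ℝ) ^ Fintype.card V * (1 / (r : ℝ) ^ 2)) := by gcongr
      _ = _ := by field_simp
  linarith

/-! ### Parameters and numerical estimates -/

/-- A product of `1 - f k` is bounded by means of the sum of the `f k`. -/
theorem prod_one_sub_le {ι : Type*} [Fintype ι] {ρ : ℝ} (hρ : 0 < ρ) (f : ι → ℝ)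
    (hf : ∀ k, f k ≤ 1) :
    ∏ k, (1 - f k) ≤
      ρ ^ Fintype.card ι * Real.exp (-((∑ k, f k - Fintype.card ι * (1 - ρ)) / ρ)) := by
  -- This is `1 + t ≤ exp t`, scaled so that equality holds at `f k = 1 - ρ`.
  have h1 : ∀ k, 1 - f k ≤ ρ * Real.exp (-((f k - (1 - ρ)) / ρ)) := by
    intro k
    calc 1 - f k = ρ * (-((f k - (1 - ρ)) / ρ) + 1) := by field_simp; ring
      _ ≤ _ := mul_le_mul_of_nonneg_left (Real.add_one_le_exp _) hρ.le
  refine (prod_le_prod (fun k _ => by linarith [hf k]) fun k _ => h1 k).trans (le_of_eq ?_)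
  rw [prod_mul_distrib, prod_const, ← Real.exp_sum, sum_neg_distrib, ← sum_div, sum_sub_distrib,
    sum_const, card_univ, nsmul_eq_mul]

/-- The inverse power is at most `exp (r * (3 / 2) / (r - 3 / 2))`. This decreases in `r`, and at `r
= 4` it equals `exp (12 / 5) < 12`. -/
theorem one_le_twelve_mul_pow {r : ℕ} (hr : 3 < r) {y : ℝ} (hy : 1 - 3 / 2 / r ≤ y) (hy1 : y ≤ 1)
    {L : ℕ} (hL : L ≤ r) : 1 ≤ 12 * y ^ L := by
  have hr' : (4 : ℝ) ≤ r := by exact_mod_cast hr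
  have h0 : (0 : ℝ) < 1 - 3 / 2 / r := by
    rw [sub_pos, div_lt_one (by linarith)]; linarith
  have h1 : (1 - 3 / 2 / (r : ℝ)) ^ r ≤ y ^ L :=
    (pow_le_pow_left₀ h0.le hy r).trans (pow_le_pow_of_le_one (h0.le.trans hy) hy1 hL)
  have h2 : (1 - 3 / 2 / (r : ℝ))⁻¹ ≤ Real.exp (3 / 2 / (r - 3 / 2)) := by
    refine le_trans (le_of_eq ?_) (Real.add_one_le_exp _)
    have h5 : (r : ℝ) - 3 / 2 ≠ 0 := by linarith
    have h6 : (r : ℝ) ≠ 0 := by linarith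
    have h7 : (1 - 3 / 2 / (r : ℝ)) = (r - 3 / 2) / r := by field_simp
    rw [h7, inv_div, eq_comm, div_add_one h5]
    congr 1
    ring
  have h3 : ((1 - 3 / 2 / (r : ℝ))⁻¹) ^ r ≤ 12 := by
    calc _ ≤ Real.exp (3 / 2 / (r - 3 / 2)) ^ r :=
          pow_le_pow_left₀ (inv_nonneg.2 h0.le) h2 r
      _ = Real.exp (r * (3 / 2 / (r - 3 / 2))) := (Real.exp_nat_mul _ _).symm
      _ ≤ Real.exp (12 / 5) := by
          refine Real.exp_le_exp.2 ?_
          rw [← mul_div_assoc, div_le_iff₀ (by linarith)]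
          linarith
      _ ≤ 12 := by
          refine le_of_pow_le_pow_left₀ (n := 5) (by norm_num) (by norm_num) ?_
          rw [← Real.exp_nat_mul]
          have h8 : ((5 : ℕ) : ℝ) * (12 / 5) = ((12 : ℕ) : ℝ) * 1 := by norm_num
          rw [h8, Real.exp_nat_mul]
          calc Real.exp 1 ^ 12 ≤ (2.7182818286 : ℝ) ^ 12 :=
                pow_le_pow_left₀ (Real.exp_pos _).le Real.exp_one_lt_d9.le _
            _ ≤ 12 ^ 5 := by norm_num
  rw [inv_pow, inv_le_comm₀ (pow_pos h0 r) (by norm_num)] at h3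
  linarith

/-- The parameters of the random weights. -/
theorem exists_parameters {n r : ℕ} (hr : 3 < r)
    (hrn : (r : ℝ) ≤ Real.sqrt ((n : ℝ) / (100 * Real.log n))) :
    1 ≤ Real.log n ∧ (1 : ℝ) ≤ n / Real.log n ∧ ∃ q : ℕ, n < q ∧
      (99 : ℝ) * r ^ 2 * n ≤ (r * q + n : ℕ) ∧
      ((r * q + n : ℕ) : ℝ) ≤ n * (n / Real.log n) ∧
      n * (n / Real.log n) ≤ 1.01 * (r * q + n : ℕ) := by
  have hr' : (4 : ℝ) ≤ r := by exact_mod_cast hr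
  have h1 : (r : ℝ) ^ 2 ≤ n / (100 * Real.log n) := (Real.le_sqrt' (by linarith)).1 hrn
  have hlog0 : 0 < Real.log n := by
    by_contra! h
    have : (n : ℝ) / (100 * Real.log n) ≤ 0 :=
      div_nonpos_of_nonneg_of_nonpos (by positivity) (by linarith)
    nlinarith
  have hn1 : 1 < n := by
    by_contra! h
    interval_cases n <;> simp at hlog0
  have hX : 100 * (r : ℝ) ^ 2 ≤ n / Real.log n := by
    rw [le_div_iff₀ (by positivity)] at h1
    rw [le_div_iff₀ hlog0]
    linarith
  -- Bootstrapping: `n ≥ 2` bounds the logarithm below, which gives `n ≥ 1000`, hence `log n ≥ 1`.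
  have hX1600 : (1600 : ℝ) ≤ n / Real.log n := by nlinarith
  have hn2 : (2 : ℝ) ≤ n := by exact_mod_cast hn1
  have hlog2 : 0.69 < Real.log n := by
    have := Real.log_le_log (by norm_num) hn2
    linarith [Real.log_two_gt_d9]
  have hn3 : (1000 : ℝ) ≤ n := by
    rw [le_div_iff₀ hlog0] at hX1600
    linarith
  have hlog1 : 1 ≤ Real.log n := by
    rw [Real.le_log_iff_exp_le (by linarith)]
    linarith [Real.exp_one_lt_d9]
  set X := (n : ℝ) / Real.log n
  have hY : 100 * (r : ℝ) ^ 2 * n ≤ n * X := by nlinarith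
  have hY2 : (n : ℝ) * (100 * r ^ 2) ≥ n * (400 * r) :=
    mul_le_mul_of_nonneg_left (by nlinarith) (by linarith)
  have hrn' : 1000 * (r : ℝ) ≤ n * r := by gcongr
  have hr1n : 4 * (n : ℝ) ≤ n * r := by nlinarith
  -- This brings `r * q + n` within `r` of `n * X`, from below.
  refine ⟨hlog1, by linarith, ⌊(n * X - n) / r⌋₊, ?_, ?_, ?_, ?_⟩
  · rw [← Nat.succ_le_iff, Nat.le_floor_iff (by apply div_nonneg <;> nlinarith),
      le_div_iff₀ (by linarith)]
    push_cast
    nlinarith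
  all_goals
    have h2 : (⌊(n * X - n) / r⌋₊ : ℝ) ≤ (n * X - n) / r :=
      Nat.floor_le (by apply div_nonneg <;> nlinarith)
    have h3 := Nat.lt_floor_add_one ((n * X - n) / r)
    rw [le_div_iff₀ (by linarith)] at h2
    rw [div_lt_iff₀ (by linarith)] at h3
    push_cast
    nlinarith

/-- The bound on the expected number of chains with `l + 1` edges. -/
theorem term_lt {n r l : ℕ} {M G : ℝ} (hr : 3 < r) (hl : l < r) (hM : 0 ≤ M)
    (hlog : 1 ≤ Real.log n) (hX : 1 ≤ n / Real.log n) (hG0 : 0 ≤ G)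
    (hG : G ≤ 20 * r ^ 2 / (n / Real.log n))
    (hcard : M ≤ 1 / (20 * (r : ℝ) ^ 2) * ((n : ℝ) / Real.log n) ^ (((r : ℝ) - 1) / r) *
        ((r : ℝ) / (r - 1)) ^ n) :
    M ^ (l + 1) * (G ^ l * (((1 - 1 / (r : ℝ)) ^ (l + 1)) ^ n *
      Real.exp (-((1 - (l + 1) / r) * Real.log n)))) < 1 / (r : ℝ) ^ 2 := by
  have hr' : (4 : ℝ) ≤ r := by exact_mod_cast hr
  set X := (n : ℝ) / Real.log n with hXdef
  have hX0 : 0 < X := by linarith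
  have hn0 : (0 : ℝ) < n := by
    rcases Nat.eq_zero_or_pos n with h | h
    · subst h; simp at hlog; linarith
    · exact_mod_cast h
  have hXn : X ≤ n := div_le_self hn0.le hlog
  have hρ0 : 0 ≤ 1 - 1 / (r : ℝ) := by
    rw [sub_nonneg, div_le_one (by linarith)]; linarith
  set ρ := 1 - 1 / (r : ℝ) with hρ
  have hρinv : (r : ℝ) / (r - 1) * ρ = 1 := by
    have h5 : (r : ℝ) - 1 ≠ 0 := by linarith
    rw [hρ]; field_simp
  have ht : M * ρ ^ n ≤ 1 / (20 * (r : ℝ) ^ 2) * X ^ (((r : ℝ) - 1) / r) := by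
    calc M * ρ ^ n ≤ (1 / (20 * (r : ℝ) ^ 2) * X ^ (((r : ℝ) - 1) / r) *
        ((r : ℝ) / (r - 1)) ^ n) * ρ ^ n := by gcongr
      _ = 1 / (20 * (r : ℝ) ^ 2) * X ^ (((r : ℝ) - 1) / r) * ((r : ℝ) / (r - 1) * ρ) ^ n := by
          rw [mul_pow]; ring
      _ = _ := by rw [hρinv]; simp
  have hexp : Real.exp (-((1 - (l + 1) / r) * Real.log n)) = ((n : ℝ) ^ (1 - ((l : ℝ) + 1) / r))⁻¹ := by
    rw [Real.exp_neg, Real.rpow_def_of_pos hn0, mul_comm]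
  have hl1 : (0 : ℝ) ≤ 1 - (l + 1) / r := by
    rw [sub_nonneg, div_le_one (by linarith)]; exact_mod_cast hl
  have hpow : X ^ (1 - ((l : ℝ) + 1) / r) ≤ (n : ℝ) ^ (1 - ((l : ℝ) + 1) / r) :=
    Real.rpow_le_rpow hX0.le hXn hl1
  -- The exponent `(l + 1) * (r - 1) / r - l` is exactly that of the saved power of `n`.
  have hXpow : (X ^ (((r : ℝ) - 1) / r)) ^ (l + 1) * (1 / X) ^ l = X ^ (1 - ((l : ℝ) + 1) / r) := by
    rw [← Real.rpow_natCast, ← Real.rpow_mul hX0.le, one_div, inv_pow, ← div_eq_mul_inv,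
      ← Real.rpow_natCast X l, ← Real.rpow_sub hX0]
    congr 1
    push_cast
    field_simp
    ring
  have hc : (0 : ℝ) < 20 * r ^ 2 := by positivity
  calc _ = (M * ρ ^ n) ^ (l + 1) * G ^ l * ((n : ℝ) ^ (1 - ((l : ℝ) + 1) / r))⁻¹ := by
        rw [hexp, mul_pow, ← pow_mul, ← pow_mul, mul_comm n]; ring
    _ ≤ (1 / (20 * (r : ℝ) ^ 2) * X ^ (((r : ℝ) - 1) / r)) ^ (l + 1) *
        (20 * r ^ 2 / X) ^ l * ((n : ℝ) ^ (1 - ((l : ℝ) + 1) / r))⁻¹ := by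
        have : 0 ≤ M * ρ ^ n := by positivity
        gcongr
    _ = 1 / (20 * (r : ℝ) ^ 2) * ((X ^ (((r : ℝ) - 1) / r)) ^ (l + 1) * (1 / X) ^ l) *
        ((n : ℝ) ^ (1 - ((l : ℝ) + 1) / r))⁻¹ := by
        generalize X ^ (((r : ℝ) - 1) / r) = Z
        generalize ((n : ℝ) ^ (1 - ((l : ℝ) + 1) / r))⁻¹ = W
        have h9 : (20 * (r : ℝ) ^ 2 / X) ^ l = (20 * (r : ℝ) ^ 2) ^ l * (1 / X) ^ l := by
          rw [← mul_pow, mul_one_div]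
        have h10 : (1 / (20 * (r : ℝ) ^ 2)) ^ (l + 1) * (20 * (r : ℝ) ^ 2) ^ l =
            1 / (20 * (r : ℝ) ^ 2) := by
          rw [pow_succ', mul_assoc, ← mul_pow, one_div_mul_cancel hc.ne', one_pow, mul_one]
        rw [h9, mul_pow]
        linear_combination (Z ^ (l + 1) * (1 / X) ^ l * W) * h10
    _ ≤ 1 / (20 * (r : ℝ) ^ 2) * (n : ℝ) ^ (1 - ((l : ℝ) + 1) / r) *
        ((n : ℝ) ^ (1 - ((l : ℝ) + 1) / r))⁻¹ := by
        rw [hXpow]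
        gcongr
    _ = 1 / (20 * (r : ℝ) ^ 2) := by
        rw [mul_assoc, mul_inv_cancel₀ (Real.rpow_pos_of_pos hn0 _).ne', mul_one]
    _ < 1 / (r : ℝ) ^ 2 := by
        apply one_div_lt_one_div_of_lt <;> nlinarith

/-- A uniform hypergraph with few edges has a panchromatic colouring. -/
theorem exists_panchromatic {V : Type*} [Fintype V] [DecidableEq V] {n r : ℕ} (hr : 3 < r)
    (hrn : (r : ℝ) ≤ Real.sqrt ((n : ℝ) / (100 * Real.log n)))
    (E : Finset (Finset V)) (hE : ∀ e ∈ E, #e = n)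
    (hcard : (#E : ℝ) ≤ 1 / (20 * (r : ℝ) ^ 2) *
      ((n : ℝ) / Real.log n) ^ (((r : ℝ) - 1) / r) * ((r : ℝ) / (r - 1)) ^ n) :
    ∃ c : V → ℕ, (∀ v, c v < r) ∧ ∀ e ∈ E, ∀ k < r, ∃ u ∈ e, c u = k := by
  have hr' : (4 : ℝ) ≤ r := by exact_mod_cast hr
  obtain ⟨hlog, hX, q, hnq, hN1, hN2, hN3⟩ := exists_parameters hr hrn
  have hn0 : (0 : ℝ) < n := by
    rcases Nat.eq_zero_or_pos n with h | h
    · subst h; simp at hlog; linarith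
    · exact_mod_cast h
  set X := (n : ℝ) / Real.log n with hXdef
  set N := r * q + n with hN
  have hNcast : (N : ℝ) = r * q + n := by rw [hN]; push_cast; ring
  have hrn2 : 4 * (r : ℝ) * n ≤ r ^ 2 * n := by gcongr; nlinarith
  have hrn1 : 4 * (n : ℝ) ≤ r * n := by gcongr
  have hN0 : (0 : ℝ) < N := by linarith
  have hρ0 : 0 < 1 - 1 / (r : ℝ) := by
    rw [sub_pos, div_lt_one (by linarith)]; linarith
  have hρ34 : 3 / 4 ≤ 1 - 1 / (r : ℝ) := by
    have : 1 / (r : ℝ) ≤ 1 / 4 := one_div_le_one_div_of_le (by norm_num) hr'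
    linarith
  -- Avoided sets have sizes between `q - n` and `q + n`, and `99 * r ^ 2 * n ≤ N`, so their
  -- densities are within 5% of `1 / r`.
  let φ : ℝ := 0.95 / r
  have hφ0 : 0 < φ := by positivity
  have hφ1 : φ ≤ 1 := by simp only [φ]; rw [div_le_one (by linarith)]; linarith
  let A : ℝ := 1 - 1.05 / r
  have hA1 : A ≤ 1 := by
    have : 0 ≤ 1.05 / (r : ℝ) := by positivity
    simp only [A]; linarith
  have hA0 : 0 ≤ A := by
    simp only [A]; rw [sub_nonneg, div_le_one (by linarith)]; linarith
  have hφ2 : φ ^ 2 ≤ 0.3 / r := by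
    simp only [φ]
    rw [div_pow, div_le_div_iff₀ (by positivity) (by linarith)]
    nlinarith
  have hAθ : 1 - 3 / 2 / r ≤ A * (1 - φ ^ 2) := by
    have h1 : A * (1 - φ ^ 2) ≥ A - φ ^ 2 := by nlinarith
    have h2 : A - 0.3 / r = 1 - 1.35 / r := by simp only [A]; ring
    have h3 : 1.35 / (r : ℝ) ≤ 3 / 2 / r := by gcongr; norm_num
    linarith
  have hAθ1 : A * (1 - φ ^ 2) ≤ 1 := by nlinarith
  have hδ : 1 ≤ n / (N : ℝ) * X := by
    rw [div_mul_eq_mul_div, le_div_iff₀ hN0]; linarith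
  have hδlog : Real.log n ≤ n * (n / (N : ℝ)) := by
    have h1 : Real.log n * X = n := by rw [hXdef]; field_simp
    calc Real.log n = Real.log n * 1 := by ring
      _ ≤ Real.log n * (n / (N : ℝ) * X) := by gcongr
      _ = (Real.log n * X) * (n / (N : ℝ)) := by ring
      _ = _ := by rw [h1]
  -- The last factor absorbs the `-l` in the total size of the avoided sets.
  let D : ℕ → ℝ := fun l => ((1 - 1 / (r : ℝ)) ^ (l + 1)) ^ n *
      Real.exp (-((1 - (l + 1) / r) * Real.log n)) * Real.exp (1 / 100) ^ l
  have hD : ∀ l < r, ∀ f : Fin (l + 1) → ℝ, (∀ k, f k ≤ 1) →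
      ∑ k, f k = ((l + 1) * q + n - l) / (N : ℝ) → (∏ k, (1 - f k)) ^ n ≤ D l := by
    intro l hl f hf hsum
    have h1 := prod_one_sub_le hρ0 f hf
    have h2 : 0 ≤ ∏ k, (1 - f k) := prod_nonneg fun k _ => by linarith [hf k]
    refine (pow_le_pow_left₀ h2 h1 n).trans ?_
    rw [mul_pow, ← Real.exp_nat_mul, Fintype.card_fin]
    simp only [D]
    rw [mul_assoc, ← Real.exp_nat_mul, ← Real.exp_add]
    refine mul_le_mul_of_nonneg_left (Real.exp_le_exp.2 ?_) (by positivity)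
    have hl1 : (0 : ℝ) ≤ 1 - (l + 1) / r := by
      rw [sub_nonneg, div_le_one (by linarith)]; exact_mod_cast hl
    have h3 : ∑ k, f k - ((l + 1 : ℕ) : ℝ) * (1 - (1 - 1 / (r : ℝ))) =
        (1 - (l + 1) / r) * (n / N) - l / N := by
      rw [hsum]
      have : (q : ℝ) = (N - n) / r := by rw [hNcast]; field_simp; ring
      rw [this]
      push_cast
      field_simp
      ring
    rw [h3]
    set ρ := 1 - 1 / (r : ℝ)
    have h4 : (1 - (l + 1) / (r : ℝ)) * Real.log n ≤
        n * ((1 - (l + 1) / (r : ℝ)) * (n / N) / ρ) := by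
      calc (1 - (l + 1) / (r : ℝ)) * Real.log n ≤
          (1 - (l + 1) / (r : ℝ)) * (n * (n / N)) := by gcongr
        _ = n * ((1 - (l + 1) / (r : ℝ)) * (n / N)) := by ring
        _ ≤ _ := by
          gcongr
          refine le_div_self (by positivity) hρ0 ?_
          have : 0 ≤ 1 / (r : ℝ) := by positivity
          simp only [ρ]
          linarith
    have h5 : (n : ℝ) * (l / N / ρ) ≤ l * (1 / 100) := by
      have : (n : ℝ) / (N * ρ) ≤ 1 / 100 := by
        rw [div_le_div_iff₀ (by positivity) (by norm_num)]
        have : (N : ℝ) * (3 / 4) ≤ N * ρ := by gcongr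
        linarith
      calc (n : ℝ) * (l / N / ρ) = l * (n / (N * ρ)) := by field_simp
        _ ≤ _ := by gcongr
    have h6 : (n : ℝ) * -(((1 - (l + 1) / (r : ℝ)) * (n / N) - l / N) / ρ) =
        n * (l / N / ρ) - n * ((1 - (l + 1) / (r : ℝ)) * (n / N) / ρ) := by ring
    rw [h6]
    linarith
  refine exists_coloring_of_term_le (q := q) (d := n) (by omega) hnq E
    (fun l => (n * 12 / (N * φ ^ 2)) ^ l * D l) ?_ ?_
  · intro j l hjl e he
    rw [← mul_assoc]
    refine sum_card_chain_le hnq hjl e (fun k => hE _ (he k)) hφ0 hφ1 hA0 hA1 ?_ ?_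
      (one_le_twelve_mul_pow hr hAθ hAθ1 (by omega)) (by norm_num) (hD l (by omega))
    · simp only [φ]
      rw [div_mul_eq_mul_div, div_le_iff₀ (by linarith)]
      linarith
    · simp only [A]
      rw [sub_sub_cancel, div_mul_eq_mul_div, le_div_iff₀ (by linarith)]
      linarith
  · intro l hl
    -- Here `0.9025 = 0.95 ^ 2`; the constants multiply to less than `14`, within the allowed `20`.
    have hG : n * 12 / (N * φ ^ 2) * Real.exp (1 / 100) ≤ 20 * r ^ 2 / X := by
      have h1 : Real.exp (1 / 100) ≤ 1.02 := by
        have := Real.exp_bound_div_one_sub_of_interval (x := 1 / 100) (by norm_num) (by norm_num)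
        refine this.trans (by norm_num)
      have h2 : n * 12 / (N * φ ^ 2) = (n * X / N) * (12 / 0.9025) * (r ^ 2 / X) := by
        simp only [φ]
        field_simp
        norm_num
      have h3 : n * X / N ≤ 1.01 := by rw [div_le_iff₀ hN0]; exact hN3
      rw [h2]
      calc n * X / N * (12 / 0.9025) * (r ^ 2 / X) * Real.exp (1 / 100)
          ≤ 1.01 * (12 / 0.9025) * (r ^ 2 / X) * 1.02 := by gcongr
        _ = (1.01 * (12 / 0.9025) * 1.02) * (r ^ 2 / X) := by ring
        _ ≤ 20 * (r ^ 2 / X) := by gcongr; norm_num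
        _ = _ := by ring
    have := term_lt hr hl (Nat.cast_nonneg #E) hlog hX (by positivity) hG hcard
    refine lt_of_eq_of_lt ?_ this
    simp only [D]
    rw [mul_pow]
    ring

end Panchromatic

/-! ### From panchromatic to fractional colourings -/

theorem mainTheorem2 {α : Type*} (n a : ℕ) (ha : 3 < a)
    (han : (a : ℝ) ≤ Real.sqrt ((n : ℝ) / (100 * Real.log (n : ℝ))))
    (H : Hypergraph α) (hH : H.IsUniform n) (hfin : H.edgeSet.Finite)
    (hcard : (H.edgeSet.ncard : ℝ) ≤
      1 / (20 * (a : ℝ) ^ 2) * ((n : ℝ) / Real.log (n : ℝ)) ^ (((a : ℝ) - 1) / (a : ℝ)) *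
        ((a : ℝ) / ((a : ℝ) - 1)) ^ n) :
    H.FractionallyColorable a (a - 1) := by
  classical
  -- The vertex set may be infinite, but only vertices lying in edges matter; the others get the
  -- default colour `0` below.
  have hW : (⋃ e ∈ H.edgeSet, e).Finite :=
    hfin.biUnion fun e he => Set.finite_of_encard_eq_coe (hH e he)
  set W : Set α := ⋃ e ∈ H.edgeSet, e with hWdef
  have : Fintype W := hW.fintype
  let f : Set α → Finset W := fun s => Finset.univ.filter fun w => (w : α) ∈ s
  have hsub : ∀ e ∈ H.edgeSet, e ⊆ W := fun e he => Set.subset_biUnion_of_mem (u := fun e => e) he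
  have hf : ∀ e ∈ H.edgeSet, (f e).card = n := by
    intro e he
    have h1 : ((f e).map (Function.Embedding.subtype _) : Set α) = e := by
      ext v
      simp only [f, Finset.coe_map, Finset.coe_filter, Finset.mem_univ, true_and, Set.mem_image,
        Set.mem_ofPred_eq, Function.Embedding.subtype_apply]
      exact ⟨fun ⟨w, hw, h⟩ => h ▸ hw, fun hv => ⟨⟨v, hsub e he hv⟩, hv, rfl⟩⟩
    have h2 := hH e he
    rw [← h1, Set.encard_coe_eq_coe_finsetCard, Finset.card_map] at h2
    exact_mod_cast h2
  obtain ⟨c, hc, hpan⟩ := Panchromatic.exists_panchromatic ha han (hfin.toFinset.image f)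
    (by
      intro e he
      obtain ⟨s, hs, rfl⟩ := Finset.mem_image.1 he
      exact hf s (hfin.mem_toFinset.1 hs))
    (by
      refine le_trans ?_ hcard
      rw [Set.ncard_eq_toFinset_card _ hfin]
      exact_mod_cast Finset.card_image_le)
  let c' : α → Fin a := fun v => if h : v ∈ W then ⟨c ⟨v, h⟩, hc _⟩ else ⟨0, by omega⟩
  -- A colour common to all vertices of an edge would be one that `c'` never takes on that edge.
  refine ⟨fun v => Finset.univ.erase (c' v), fun v _ => ?_, ?_⟩
  · rw [Finset.card_erase_of_mem (Finset.mem_univ _), Finset.card_univ, Fintype.card_fin]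
  · rintro e he ⟨i, hi⟩
    obtain ⟨u, hu, hui⟩ := hpan (f e)
      (Finset.mem_image_of_mem f (hfin.mem_toFinset.2 he)) i i.2
    have h1 := hi u (by simpa [f] using hu)
    refine (Finset.mem_erase.1 h1).1 (Fin.ext ?_)
    simp only [c', u.2, dif_pos, Subtype.coe_eta]
    exact hui.symm
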